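/- Let $\{0,1\}^n$ index the computational basis of $\mathbb{C}^{2^n}$, let $\mathbb{E}_U$ denote expectation over a Haar-random $2^n\times 2^n$ unitary $U$, and let $\mathrm{TD}(\rho,\sigma)=\frac12\|\rho-\sigma\|_1$ be the trace distance. (1) There is an absolute constant $C$ such that for all $n,s,t\in\mathbb{N}$ and all pairwise distinct $x_1,\dots,x_s\in\{0,1\}^n$, the states $$\rho:=\mathbb{E}_{U}\Big[\bigotimes_{j=1}^{s}\big(U|x_j\rangle\langle x_j|U^{\dagger}\big)^{\otimes t}\Big],\qquad \sigma:=\bigotimes_{j=1}^{s}\mathbb{E}_{U_j}\Big[\big(U_j|0^n\rangle\langle 0^n|U_j^{\dagger}\big)^{\otimes t}\Big]$$ ($U_1,\dots,U_s$ Haar-random unitaries, so that $\sigma$ consists of $t$ copies each of $s$ independent Haar states) satisfy $\mathrm{TD}(\rho,\sigma)\le C\,s^2t/2^n$. (2) There is an absolute constant $C$ such that for all $n,q\in\mathbb{N}$ and every $\vec{x}=(x_1,\dots,x_q)$ of pairwise distinct strings $x_i\in\{0,1\}^n$, with $|\vec x\rangle=|x_1\rangle\otimes\cdots\otimes|x_q\rangle$,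 the states $$\rho:=\mathbb{E}_{U}\big[U^{\otimes q}|\vec{x}\rangle\langle\vec{x}|(U^{\dagger})^{\otimes q}\big],\qquad \sigma:=\frac{1}{|\mathcal{S}_{n,q}|}\sum_{\vec z\in\mathcal{S}_{n,q}}|\vec z\rangle\langle\vec z|,$$ where $\mathcal{S}_{n,q}$ is the set of $q$-tuples of pairwise distinct strings in $\{0,1\}^n$, satisfy $\mathrm{TD}(\rho,\sigma)\le C\,q^2/2^n$. -/

import Mathlib

open scoped Matrix

noncomputable section

namespace HaarPerp

/-- Bit strings of length `n`; they index the computational basis of `n` qubits. -/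
abbrev BitString (n : ℕ) : Type := Fin n → Bool

/-- The group of `2^n × 2^n` unitary matrices. -/
abbrev UnitaryOp (n : ℕ) : Type := Matrix.unitaryGroup (BitString n) ℂ

instance instMeasurableSpaceUnitaryOp (n : ℕ) : MeasurableSpace (UnitaryOp n) :=
  borel (UnitaryOp n)

instance instBorelSpaceUnitaryOp (n : ℕ) : BorelSpace (UnitaryOp n) := ⟨rfl⟩

instance instCompactSpaceUnitaryOp (n : ℕ) : CompactSpace (UnitaryOp n) := by
  have hK : IsCompact (Set.univ.pi fun _ : BitString n =>
      Set.univ.pi fun _ : BitString n => Metric.closedBall (0 : ℂ) 1) :=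
    isCompact_univ_pi fun _ => isCompact_univ_pi fun _ => isCompact_closedBall 0 1
  have hcl : IsClosed {A : Matrix (BitString n) (BitString n) ℂ |
      A ∈ Matrix.unitaryGroup (BitString n) ℂ} := by
    have h : {A : Matrix (BitString n) (BitString n) ℂ |
        A ∈ Matrix.unitaryGroup (BitString n) ℂ} = {A | A * star A = 1} := by
      ext A
      exact Matrix.mem_unitaryGroup_iff
    rw [h]
    exact isClosed_eq (continuous_id.mul continuous_star) continuous_const
  apply isCompact_iff_compactSpace.mp
  refine IsCompact.of_isClosed_subset hK hcl ?_
  intro A hA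
  exact fun i _ j _ => mem_closedBall_zero_iff.mpr (entry_norm_bound_of_unitary hA i j)

/-- The Haar probability measure on the group of `2^n × 2^n` unitary matrices: the left-invariant
measure of total mass one. -/
def haarUnitary (n : ℕ) : MeasureTheory.Measure (UnitaryOp n) :=
  MeasureTheory.Measure.haarMeasure ⊤

instance instIsHaarMeasureHaarUnitary (n : ℕ) : (haarUnitary n).IsHaarMeasure := by
  unfold haarUnitary
  infer_instance

instance instIsProbabilityMeasureHaarUnitary (n : ℕ) :
    MeasureTheory.IsProbabilityMeasure (haarUnitary n) :=
  ⟨by simpa [haarUnitary] using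
    MeasureTheory.Measure.haarMeasure_self (K₀ := (⊤ : TopologicalSpace.PositiveCompacts
      (UnitaryOp n)))⟩

/-- The expectation `E_U [F U]` over a Haar unitary `U` of a matrix-valued function, taken entry by
entry. -/
def haarExpect (n : ℕ) {κ : Type} (F : UnitaryOp n → Matrix κ κ ℂ) : Matrix κ κ ℂ :=
  Matrix.of fun a b => ∫ U, F U a b ∂(haarUnitary n)

/-- The rank-one operator `|x⟩⟨x|` of a computational basis vector. -/
def basisProj {κ : Type} [DecidableEq κ] (x : κ) : Matrix κ κ ℂ :=
  Matrix.single x x 1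

/-- The tensor product `⨂ i, A i` of a finite family of square matrices. The tensor product of the
spaces `ℂ^κ` over `i : ι` has the basis `|a⟩ = ⨂ i, |a i⟩`, `a : ι → κ`, and
`⟨a| ⨂ i, A i |b⟩ = ∏ i, ⟨a i| A i |b i⟩`. -/
def tensor {ι κ : Type} [Fintype ι] (A : ι → Matrix κ κ ℂ) : Matrix (ι → κ) (ι → κ) ℂ :=
  Matrix.of fun a b => ∏ i, A i (a i) (b i)

/-- The tensor power `A^{⊗ t}`. -/
def tensorPow {κ : Type} (t : ℕ) (A : Matrix κ κ ℂ) : Matrix (Fin t → κ) (Fin t → κ) ℂ :=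
  tensor fun _ : Fin t => A

/-- The trace norm `‖A‖₁ = Tr √(Aᴴ A)`: the sum of the singular values of `A`, which are the square
roots of the eigenvalues of `Aᴴ A` counted with multiplicity. -/
def traceNorm {κ : Type} [Fintype κ] [DecidableEq κ] (A : Matrix κ κ ℂ) : ℝ :=
  ∑ i, √((Matrix.isHermitian_conjTranspose_mul_self A).eigenvalues i)

/-- The trace distance `‖ρ - σ‖₁ / 2`. -/
def traceDist {κ : Type} [Fintype κ] [DecidableEq κ] (ρ σ : Matrix κ κ ℂ) : ℝ :=
  traceNorm (ρ - σ) / 2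

/-- `E_U ⨂_j (U |x_j⟩⟨x_j| U†)^{⊗ t}` for one Haar unitary `U` on `n` qubits. -/
def commonHaarState (n s t : ℕ) (x : Fin s → BitString n) :
    Matrix (Fin s → Fin t → BitString n) (Fin s → Fin t → BitString n) ℂ :=
  haarExpect n fun U => tensor fun j : Fin s =>
    tensorPow t ((U : Matrix (BitString n) (BitString n) ℂ) * basisProj (x j) *
      (U : Matrix (BitString n) (BitString n) ℂ)ᴴ)

/-- `⨂_j E_{U_j} (U_j |0^n⟩⟨0^n| U_j†)^{⊗ t}`: `t` copies each of `s` independent Haar states. -/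
def iidHaarState (n s t : ℕ) :
    Matrix (Fin s → Fin t → BitString n) (Fin s → Fin t → BitString n) ℂ :=
  tensor fun _ : Fin s => haarExpect n fun U =>
    tensorPow t ((U : Matrix (BitString n) (BitString n) ℂ) * basisProj (fun _ => false) *
      (U : Matrix (BitString n) (BitString n) ℂ)ᴴ)

/-- `E_U U^{⊗ q} |x⃗⟩⟨x⃗| (U†)^{⊗ q}` for a Haar unitary `U` on `n` qubits. -/
def haarTwirl (n q : ℕ) (x : Fin q → BitString n) :
    Matrix (Fin q → BitString n) (Fin q → BitString n) ℂ :=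
  haarExpect n fun U =>
    tensorPow q (U : Matrix (BitString n) (BitString n) ℂ) * basisProj x *
      tensorPow q (U : Matrix (BitString n) (BitString n) ℂ)ᴴ

open Classical in
/-- The `q`-tuples of pairwise distinct `n`-bit strings. -/
def distinctTuples (n q : ℕ) : Finset (Fin q → BitString n) :=
  Finset.univ.filter fun z => Function.Injective z

/-- The uniform mixture of `|z⃗⟩⟨z⃗|` over all tuples `z⃗` of `q` pairwise distinct strings. -/
def collisionFreeMixture (n q : ℕ) :
    Matrix (Fin q → BitString n) (Fin q → BitString n) ℂ :=
  ((distinctTuples n q).card : ℂ)⁻¹ • ∑ z ∈ distinctTuples n q, basisProj z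

end HaarPerp

end

/-!
Both bounds come from exhibiting the difference of the two states as `P - Q` with `P`, `Q` positive
semidefinite of small trace, since then `‖P - Q‖₁ ≤ tr P + tr Q` (`traceNorm_sub_le`). The twirl
`M ↦ E_U R(U) M R(U)†` of a unitary representation `R` preserves positivity and trace, and it does
not change when `M` is first conjugated by some `R(V)` (`twirl_conj`), because Haar measure on a
compact group is right-invariant.

For one query to each of `q` distinct inputs (`traceDist_haarTwirl_le`): any tuple of distinct basis
vectors is moved to any other by a unitary, so `ρ` is the twirl of the collision-free mixture `σ`.
The maximally mixed state is its own twirl and differs from `σ` by the probability of a collision,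
so twirling moves `σ` by at most twice that amount.

For `t` copies (`traceDist_commonHaarState_le`): the hybrid `H_k` is the twirl of `|x_j⟩^{⊗ t}` in
the registers `j < k` and the `t`-copy Haar state `τ` in the others, so that `H_0` is the product of
independent Haar states and `H_s` is `ρ`. Let `A` be the compression of `τ` to the `t`-th power of
the space orthogonal to `|x_j⟩`, `j < k`. Invariance of `τ` under phases gives `τ = A + B` with `B`
positive (`haarPow_eq_add`). The state `A` is a mixture of `(v v†)^{⊗ t}` for unnormalized vectors
`v` orthogonal to those `|x_j⟩`; a unitary fixing the `|x_j⟩` takes `|x_k⟩` to the direction of `v`,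
so after twirling each such term is `‖v‖ ^ (2 t)` times `H_{k+1}` (`twirl_tensorSlot_vecMulVec`).
Hence `H_k = c H_{k+1} + Q` with `Q` positive of trace `1 - c`, where `c` is the mean of
`‖v‖ ^ (2 t)`. The mean of `1 - ‖v‖ ^ 2` is `k / 2 ^ n`, so `1 - c ≤ t k / 2 ^ n ≤ t s / 2 ^ n` by
Bernoulli's inequality (`le_avoidWeight`), and summing over `k < s` gives the bound.
-/

namespace HaarPerp

open MeasureTheory ComplexOrder

/-! ### Trace norm of a difference of positive matrices -/

section TraceNorm

variable {κ : Type} [Fintype κ] [DecidableEq κ]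

theorem traceNorm_eq_sum_abs_eigenvalues {A : Matrix κ κ ℂ} (hA : A.IsHermitian) :
    traceNorm A = ∑ i, |hA.eigenvalues i| := by
  have hchar : (Aᴴ * A).charpoly =
      ∏ i, (Polynomial.X - Polynomial.C ((hA.eigenvalues i ^ 2 : ℝ) : ℂ)) := by
    have h2 : Aᴴ * A = (hA.eigenvectorUnitary : Matrix κ κ ℂ) *
        Matrix.diagonal (fun i => ((hA.eigenvalues i ^ 2 : ℝ) : ℂ)) *
        star (hA.eigenvectorUnitary : Matrix κ κ ℂ) := by
      have hU : star (hA.eigenvectorUnitary : Matrix κ κ ℂ) *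
          (hA.eigenvectorUnitary : Matrix κ κ ℂ) = 1 := by simp
      have hsp := hA.spectral_theorem
      rw [Unitary.conjStarAlgAut_apply] at hsp
      rw [hA.eq]
      conv_lhs => rw [hsp]
      rw [show ∀ U D S : Matrix κ κ ℂ, U * D * S * (U * D * S) = U * (D * (S * U) * D) * S from
        fun U D S => by simp only [Matrix.mul_assoc], hU, Matrix.mul_one,
        Matrix.diagonal_mul_diagonal]
      congr 3
      ext i
      simp [pow_two]
    rw [h2, Matrix.charpoly_mul_comm, ← Matrix.mul_assoc]
    simp [Matrix.charpoly_diagonal]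
  have hroots : Multiset.map (RCLike.ofReal ∘
      (Matrix.isHermitian_conjTranspose_mul_self A).eigenvalues) Finset.univ.val =
      Multiset.map (fun i => ((hA.eigenvalues i ^ 2 : ℝ) : ℂ)) Finset.univ.val := by
    rw [← Matrix.IsHermitian.roots_charpoly_eq_eigenvalues, hchar, Polynomial.roots_prod]
    · simp only [Polynomial.roots_X_sub_C, Multiset.bind_singleton]
    · exact Finset.prod_ne_zero_iff.mpr fun i _ => Polynomial.X_sub_C_ne_zero _
  have h := congrArg (fun m => (m.map fun z : ℂ => √z.re).sum) hroots
  simp only [Multiset.map_map, Function.comp_def] at h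
  simpa [traceNorm, Real.sqrt_sq_eq_abs, ← Complex.ofReal_pow] using h

/-- The eigenvalues of `P - Q` are differences of diagonal entries of `P` and `Q` in an eigenbasis
of `P - Q`, and those entries are nonnegative. -/
theorem traceNorm_sub_le {P Q : Matrix κ κ ℂ} (hP : P.PosSemidef) (hQ : Q.PosSemidef) :
    traceNorm (P - Q) ≤ P.trace.re + Q.trace.re := by
  have hA : (P - Q).IsHermitian := hP.isHermitian.sub hQ.isHermitian
  rw [traceNorm_eq_sum_abs_eigenvalues hA]
  set U : Matrix κ κ ℂ := (hA.eigenvectorUnitary : Matrix κ κ ℂ) with hUdef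
  have hU : U * Uᴴ = 1 := by
    simp [hUdef, ← Matrix.star_eq_conjTranspose]
  have hU' : Uᴴ * U = 1 := by
    simp [hUdef, ← Matrix.star_eq_conjTranspose]
  have htr : ∀ M : Matrix κ κ ℂ, (Uᴴ * M * U).trace = M.trace := fun M => by
    rw [Matrix.trace_mul_comm, ← Matrix.mul_assoc, hU, Matrix.one_mul]
  have hdiag : Uᴴ * (P - Q) * U = Matrix.diagonal (RCLike.ofReal ∘ hA.eigenvalues) := by
    have hsp := hA.spectral_theorem
    rw [Unitary.conjStarAlgAut_apply, ← hUdef, Matrix.star_eq_conjTranspose] at hsp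
    conv_lhs => rw [hsp]
    rw [show ∀ D : Matrix κ κ ℂ, Uᴴ * (U * D * Uᴴ) * U = (Uᴴ * U) * D * (Uᴴ * U) from
      fun D => by simp only [Matrix.mul_assoc], hU', Matrix.one_mul, Matrix.mul_one]
  have hP' := hP.conjTranspose_mul_mul_same U
  have hQ' := hQ.conjTranspose_mul_mul_same U
  have hev : ∀ i, |hA.eigenvalues i| ≤ ((Uᴴ * P * U) i i).re + ((Uᴴ * Q * U) i i).re := by
    intro i
    have h := congrFun (congrFun hdiag i) i
    rw [Matrix.mul_sub, Matrix.sub_mul, Matrix.sub_apply, Matrix.diagonal_apply_eq] at h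
    have hre := congrArg Complex.re h
    simp only [Complex.sub_re, Function.comp_apply, RCLike.ofReal_eq_complex_ofReal,
      Complex.ofReal_re] at hre
    have h1 := (Complex.le_def.1 (hP'.diag_nonneg (i := i))).1
    have h2 := (Complex.le_def.1 (hQ'.diag_nonneg (i := i))).1
    simp only [Complex.zero_re] at h1 h2
    rw [← hre, abs_le]
    constructor <;> linarith
  calc ∑ i, |hA.eigenvalues i|
      ≤ ∑ i, (((Uᴴ * P * U) i i).re + ((Uᴴ * Q * U) i i).re) := Finset.sum_le_sum fun i _ => hev i
    _ = (Uᴴ * P * U).trace.re + (Uᴴ * Q * U).trace.re := by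
        simp [Finset.sum_add_distrib, Matrix.trace]
    _ = P.trace.re + Q.trace.re := by rw [htr, htr]

theorem exists_eq_conjTranspose_mul_self {A : Matrix κ κ ℂ} (hA : A.PosSemidef) :
    ∃ C : Matrix κ κ ℂ, A = Cᴴ * C := by
  open scoped MatrixOrder in
  obtain ⟨C, hC, -, h⟩ := CFC.exists_sqrt_of_isSelfAdjoint_of_quasispectrumRestricts
    hA.isHermitian (QuasispectrumRestricts.nnreal_of_nonneg hA.nonneg)
  exact ⟨C, by rw [← h, ← Matrix.star_eq_conjTranspose, hC.star_eq]⟩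

end TraceNorm

/-! ### Haar expectations of matrices -/

section HaarExpect

variable {n : ℕ} {κ : Type}

/-- Translating Haar measure on the right gives a left-invariant probability measure again, and
there is only one. -/
instance instIsMulRightInvariantHaarUnitary (n : ℕ) : (haarUnitary n).IsMulRightInvariant := by
  refine ⟨fun g => ?_⟩
  have : IsProbabilityMeasure ((haarUnitary n).map (· * g)) :=
    Measure.isProbabilityMeasure_map (by fun_prop)
  exact Measure.isHaarMeasure_eq_of_isProbabilityMeasure _ _

theorem integrable_haarUnitary {E : Type*} [NormedAddCommGroup E] {f : UnitaryOp n → E}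
    (hf : Continuous f) : Integrable f (haarUnitary n) :=
  hf.integrable_of_hasCompactSupport (HasCompactSupport.of_compactSpace f)

theorem haarExpect_mul_left (F : UnitaryOp n → Matrix κ κ ℂ) (V : UnitaryOp n) :
    haarExpect n (fun U => F (V * U)) = haarExpect n F := by
  ext a b
  exact integral_mul_left_eq_self (fun U => F U a b) V

theorem haarExpect_mul_right (F : UnitaryOp n → Matrix κ κ ℂ) (V : UnitaryOp n) :
    haarExpect n (fun U => F (U * V)) = haarExpect n F := by
  ext a b
  exact integral_mul_right_eq_self (fun U => F U a b) V

theorem haarExpect_const (M : Matrix κ κ ℂ) : haarExpect n (fun _ => M) = M := by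
  ext a b
  simp [haarExpect]

theorem haarExpect_integral_smul (f : UnitaryOp n → ℂ) (M : Matrix κ κ ℂ) :
    haarExpect n (fun U => f U • M) = (∫ U, f U ∂haarUnitary n) • M := by
  ext a b
  simp [haarExpect, integral_mul_const]

variable [Fintype κ] [DecidableEq κ]

theorem map_haarExpect (L : Matrix κ κ ℂ →ₗ[ℂ] ℂ) {F : UnitaryOp n → Matrix κ κ ℂ}
    (hF : Continuous F) : L (haarExpect n F) = ∫ U, L (F U) ∂haarUnitary n := by
  have hL : ∀ M : Matrix κ κ ℂ, L M = ∑ a, ∑ b, M a b * L (Matrix.single a b 1) := by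
    intro M
    conv_lhs => rw [Matrix.matrix_eq_sum_single M]
    simp only [map_sum]
    refine Finset.sum_congr rfl fun a _ => Finset.sum_congr rfl fun b _ => ?_
    rw [← smul_eq_mul, ← map_smul, Matrix.smul_single, smul_eq_mul, mul_one]
  have hint : ∀ a b, Integrable (fun U => F U a b * L (Matrix.single a b 1)) (haarUnitary n) :=
    fun a b => integrable_haarUnitary ((hF.matrix_elem a b).mul continuous_const)
  rw [hL]
  simp_rw [hL (F _)]
  rw [integral_finsetSum _ fun a _ => integrable_finsetSum _ fun b _ => hint a b]
  refine Finset.sum_congr rfl fun a _ => ?_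
  rw [integral_finsetSum _ fun b _ => hint a b]
  refine Finset.sum_congr rfl fun b _ => ?_
  rw [integral_mul_const]
  rfl

theorem map_haarExpect_matrix {ν : Type} (L : Matrix κ κ ℂ →ₗ[ℂ] Matrix ν ν ℂ)
    {F : UnitaryOp n → Matrix κ κ ℂ} (hF : Continuous F) :
    L (haarExpect n F) = haarExpect n fun U => L (F U) := by
  ext a b
  exact map_haarExpect ((Matrix.entryLinearMap ℂ ℂ a b).comp L) hF

theorem mul_haarExpect_mul (A B : Matrix κ κ ℂ) {F : UnitaryOp n → Matrix κ κ ℂ}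
    (hF : Continuous F) :
    A * haarExpect n F * B = haarExpect n fun U => A * F U * B :=
  map_haarExpect_matrix ((LinearMap.mulRight ℂ B).comp (LinearMap.mulLeft ℂ A)) hF

theorem trace_haarExpect {F : UnitaryOp n → Matrix κ κ ℂ} (hF : Continuous F) :
    (haarExpect n F).trace = ∫ U, (F U).trace ∂haarUnitary n :=
  map_haarExpect (Matrix.traceLinearMap κ ℂ ℂ) hF

theorem posSemidef_haarExpect {F : UnitaryOp n → Matrix κ κ ℂ} (hF : Continuous F)
    (h : ∀ U, (F U).PosSemidef) : (haarExpect n F).PosSemidef := by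
  refine Matrix.PosSemidef.of_dotProduct_mulVec_nonneg ?_ fun v => ?_
  · ext a b
    rw [Matrix.conjTranspose_apply]
    change star (∫ U, F U b a ∂haarUnitary n) = ∫ U, F U a b ∂haarUnitary n
    rw [← starRingEnd_apply, ← integral_conj]
    exact integral_congr_ae (Filter.Eventually.of_forall fun U => (h U).isHermitian.apply a b)
  · let L : Matrix κ κ ℂ →ₗ[ℂ] ℂ :=
      { toFun := fun M => star v ⬝ᵥ M *ᵥ v
        map_add' := fun M N => by rw [Matrix.add_mulVec, dotProduct_add]
        map_smul' := fun c M => by rw [Matrix.smul_mulVec, dotProduct_smul, RingHom.id_apply] }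
    change 0 ≤ L (haarExpect n F)
    rw [map_haarExpect L hF]
    exact integral_nonneg fun U => (h U).dotProduct_mulVec_nonneg v

end HaarExpect

/-! ### Twirling by a unitary representation -/

section Twirl

variable {n : ℕ} {κ : Type} [Fintype κ] [DecidableEq κ]

theorem continuous_conj_rep (R : UnitaryOp n →ₜ* Matrix.unitaryGroup κ ℂ) (M : Matrix κ κ ℂ) :
    Continuous fun U => (R U : Matrix κ κ ℂ) * M * (R U : Matrix κ κ ℂ)ᴴ := by
  have h : Continuous fun U => (R U : Matrix κ κ ℂ) := continuous_subtype_val.comp R.continuous_toFun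
  exact (h.mul continuous_const).mul h.matrix_conjTranspose

/-- The twirl `M ↦ E_U R(U) M R(U)ᴴ` of a continuous unitary representation `R` of the group of
`2^n × 2^n` unitaries. -/
noncomputable def twirl (R : UnitaryOp n →ₜ* Matrix.unitaryGroup κ ℂ) :
    Matrix κ κ ℂ →ₗ[ℂ] Matrix κ κ ℂ where
  toFun M := haarExpect n fun U => (R U : Matrix κ κ ℂ) * M * (R U : Matrix κ κ ℂ)ᴴ
  map_add' M N := by
    ext a b
    simp only [Matrix.mul_add, Matrix.add_mul]
    exact integral_add (integrable_haarUnitary ((continuous_conj_rep R M).matrix_elem a b))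
      (integrable_haarUnitary ((continuous_conj_rep R N).matrix_elem a b))
  map_smul' c M := by
    ext a b
    simp only [Matrix.mul_smul, Matrix.smul_mul, RingHom.id_apply]
    exact integral_const_mul c _

variable (R : UnitaryOp n →ₜ* Matrix.unitaryGroup κ ℂ)

theorem twirl_apply (M : Matrix κ κ ℂ) :
    twirl R M = haarExpect n fun U => (R U : Matrix κ κ ℂ) * M * (R U : Matrix κ κ ℂ)ᴴ := rfl

theorem posSemidef_twirl {M : Matrix κ κ ℂ} (hM : M.PosSemidef) : (twirl R M).PosSemidef :=
  posSemidef_haarExpect (continuous_conj_rep R M) fun _ => hM.mul_mul_conjTranspose_same _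

theorem trace_twirl (M : Matrix κ κ ℂ) : (twirl R M).trace = M.trace := by
  rw [twirl_apply, trace_haarExpect (continuous_conj_rep R M)]
  have h : ∀ U, ((R U : Matrix κ κ ℂ) * M * (R U : Matrix κ κ ℂ)ᴴ).trace = M.trace := fun U => by
    rw [Matrix.trace_mul_comm, ← Matrix.mul_assoc, ← Matrix.star_eq_conjTranspose,
      Matrix.UnitaryGroup.star_mul_self, Matrix.one_mul]
  simp [h]

theorem twirl_conj (V : UnitaryOp n) (M : Matrix κ κ ℂ) :
    twirl R ((R V : Matrix κ κ ℂ) * M * (R V : Matrix κ κ ℂ)ᴴ) = twirl R M := by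
  conv_rhs => rw [twirl_apply, ← haarExpect_mul_right _ V]
  rw [twirl_apply]
  simp [Matrix.mul_assoc, Matrix.conjTranspose_mul]

theorem conj_twirl (V : UnitaryOp n) (M : Matrix κ κ ℂ) :
    (R V : Matrix κ κ ℂ) * twirl R M * (R V : Matrix κ κ ℂ)ᴴ = twirl R M := by
  conv_rhs => rw [twirl_apply, ← haarExpect_mul_left _ V]
  rw [twirl_apply, mul_haarExpect_mul _ _ (continuous_conj_rep R M)]
  simp [Matrix.mul_assoc, Matrix.conjTranspose_mul]

theorem twirl_eq_self {M : Matrix κ κ ℂ}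
    (hM : ∀ V, (R V : Matrix κ κ ℂ) * M * (R V : Matrix κ κ ℂ)ᴴ = M) : twirl R M = M := by
  rw [twirl_apply]
  simp only [hM, haarExpect_const]

end Twirl

/-! ### Tensor products -/

section Tensor

variable {ι κ : Type} [Fintype ι]

theorem tensor_apply (A : ι → Matrix κ κ ℂ) (a b : ι → κ) :
    tensor A a b = ∏ i, A i (a i) (b i) := rfl

theorem tensor_conjTranspose (A : ι → Matrix κ κ ℂ) : (tensor A)ᴴ = tensor fun i => (A i)ᴴ := by
  ext a b
  simp [tensor_apply]

theorem tensor_one [DecidableEq κ] [DecidableEq ι] :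
    tensor (fun _ : ι => (1 : Matrix κ κ ℂ)) = 1 := by
  ext a b
  rw [tensor_apply]
  simp only [Matrix.one_apply, funext_iff]
  rw [Finset.prod_ite_zero]
  simp

theorem tensor_basisProj [DecidableEq κ] [DecidableEq ι] (x : ι → κ) :
    tensor (fun i => basisProj (x i)) = basisProj x := by
  ext a b
  rw [tensor_apply]
  simp only [basisProj, Matrix.single_apply, funext_iff]
  rw [Finset.prod_ite_zero]
  simp [forall_and]

theorem tensor_smul (c : ι → ℂ) (A : ι → Matrix κ κ ℂ) :
    tensor (fun i => c i • A i) = (∏ i, c i) • tensor A := by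
  ext a b
  simp [tensor_apply, Finset.prod_mul_distrib]

theorem continuous_tensor {X : Type*} [TopologicalSpace X] {A : X → ι → Matrix κ κ ℂ}
    (hA : ∀ i, Continuous fun x => A x i) : Continuous fun x => tensor (A x) :=
  continuous_matrix fun a b => continuous_finsetProd _ fun i _ => (hA i).matrix_elem (a i) (b i)

variable [DecidableEq ι]

/-- The tensor product as a linear function of its factor in position `k`. -/
def tensorSlot (X : ι → Matrix κ κ ℂ) (k : ι) : Matrix κ κ ℂ →ₗ[ℂ] Matrix (ι → κ) (ι → κ) ℂ where
  toFun M := tensor (Function.update X k M)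
  map_add' M N := by
    ext a b
    simp only [tensor_apply, Matrix.add_apply, ← Finset.mul_prod_erase _ _ (Finset.mem_univ k),
      Function.update_self, add_mul]
    congr 2 <;>
    exact Finset.prod_congr rfl fun i hi => by
      simp [Function.update_of_ne (Finset.ne_of_mem_erase hi)]
  map_smul' c M := by
    ext a b
    simp only [tensor_apply, Matrix.smul_apply, ← Finset.mul_prod_erase _ _ (Finset.mem_univ k),
      Function.update_self, smul_eq_mul, mul_assoc, RingHom.id_apply]
    congr 2
    exact Finset.prod_congr rfl fun i hi => by
      simp [Function.update_of_ne (Finset.ne_of_mem_erase hi)]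

theorem tensorSlot_apply (X : ι → Matrix κ κ ℂ) (k : ι) (M : Matrix κ κ ℂ) :
    tensorSlot X k M = tensor (Function.update X k M) := rfl

variable [Fintype κ]

theorem tensor_mul (A B : ι → Matrix κ κ ℂ) :
    (tensor fun i => A i * B i) = tensor A * tensor B := by
  ext a b
  simp only [tensor_apply, Matrix.mul_apply, Finset.prod_univ_sum, Fintype.piFinset_univ,
    Finset.prod_mul_distrib]

theorem trace_tensor (A : ι → Matrix κ κ ℂ) : (tensor A).trace = ∏ i, (A i).trace := by
  simp [Matrix.trace, tensor_apply, Finset.prod_univ_sum]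

theorem posSemidef_tensor [DecidableEq κ] {A : ι → Matrix κ κ ℂ} (hA : ∀ i, (A i).PosSemidef) :
    (tensor A).PosSemidef := by
  choose C hC using fun i => exists_eq_conjTranspose_mul_self (hA i)
  have h : tensor A = (tensor C)ᴴ * tensor C := by
    rw [tensor_conjTranspose, ← tensor_mul]
    exact congrArg tensor (funext hC)
  rw [h]
  exact Matrix.posSemidef_conjTranspose_mul_self _

theorem tensor_mem_unitaryGroup [DecidableEq κ] {A : ι → Matrix κ κ ℂ}
    (hA : ∀ i, A i ∈ Matrix.unitaryGroup κ ℂ) : tensor A ∈ Matrix.unitaryGroup (ι → κ) ℂ := by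
  rw [Matrix.mem_unitaryGroup_iff, Matrix.star_eq_conjTranspose, tensor_conjTranspose,
    ← tensor_mul, ← tensor_one]
  exact congrArg tensor (funext fun i => Matrix.mem_unitaryGroup_iff.mp (hA i))

variable (ι) in
/-- The representation `U ↦ R(U)^{⊗ ι}`. -/
noncomputable def tensorRep [DecidableEq κ] {n : ℕ} (R : UnitaryOp n →ₜ* Matrix.unitaryGroup κ ℂ) :
    UnitaryOp n →ₜ* Matrix.unitaryGroup (ι → κ) ℂ where
  toFun U := ⟨tensor fun _ : ι => (R U : Matrix κ κ ℂ), tensor_mem_unitaryGroup fun _ => (R U).2⟩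
  map_one' := Subtype.ext <| by simp [tensor_one]
  map_mul' U V := Subtype.ext <| by simp [← tensor_mul]
  continuous_toFun := Continuous.subtype_mk
    (continuous_tensor fun _ => continuous_subtype_val.comp R.continuous_toFun) _

theorem coe_tensorRep [DecidableEq κ] {n : ℕ} (R : UnitaryOp n →ₜ* Matrix.unitaryGroup κ ℂ)
    (U : UnitaryOp n) :
    (tensorRep ι R U : Matrix (ι → κ) (ι → κ) ℂ) = tensor fun _ => (R U : Matrix κ κ ℂ) := rfl

theorem tensorRep_conj [DecidableEq κ] {n : ℕ} (R : UnitaryOp n →ₜ* Matrix.unitaryGroup κ ℂ)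
    (U : UnitaryOp n) (A : ι → Matrix κ κ ℂ) :
    (tensorRep ι R U : Matrix (ι → κ) (ι → κ) ℂ) * tensor A *
      (tensorRep ι R U : Matrix (ι → κ) (ι → κ) ℂ)ᴴ =
    tensor fun i => (R U : Matrix κ κ ℂ) * A i * (R U : Matrix κ κ ℂ)ᴴ := by
  rw [coe_tensorRep, tensor_conjTranspose, ← tensor_mul, ← tensor_mul]

end Tensor

/-! ### Basis projections and unitaries -/

theorem posSemidef_basisProj {κ : Type} [Fintype κ] [DecidableEq κ] (x : κ) :
    (basisProj x).PosSemidef := by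
  have h : basisProj x = (basisProj x)ᴴ * basisProj x := by
    simp [basisProj]
  rw [h]
  exact Matrix.posSemidef_conjTranspose_mul_self _

theorem trace_basisProj {κ : Type} [Fintype κ] [DecidableEq κ] (x : κ) :
    (basisProj x).trace = 1 := by
  simp [basisProj]

/-- The representation `U ↦ U^{⊗ t}`. -/
noncomputable abbrev powRep (n t : ℕ) :
    UnitaryOp n →ₜ* Matrix.unitaryGroup (Fin t → BitString n) ℂ :=
  tensorRep (Fin t) (ContinuousMonoidHom.id _)

theorem coe_powRep (n t : ℕ) (U : UnitaryOp n) :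
    (powRep n t U : Matrix (Fin t → BitString n) (Fin t → BitString n) ℂ) =
      tensorPow t (U : Matrix (BitString n) (BitString n) ℂ) := rfl

theorem powRep_conj (n t : ℕ) (U : UnitaryOp n) (M : Matrix (BitString n) (BitString n) ℂ) :
    (powRep n t U : Matrix (Fin t → BitString n) (Fin t → BitString n) ℂ) * tensorPow t M *
      (powRep n t U : Matrix (Fin t → BitString n) (Fin t → BitString n) ℂ)ᴴ =
    tensorPow t ((U : Matrix (BitString n) (BitString n) ℂ) * M *
      (U : Matrix (BitString n) (BitString n) ℂ)ᴴ) :=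
  tensorRep_conj _ U _

/-- A partial orthonormal family extends to the columns of a unitary. -/
theorem exists_unitary_of_orthonormal {n : ℕ} {v : BitString n → EuclideanSpace ℂ (BitString n)}
    {s : Set (BitString n)} (hv : Orthonormal ℂ (s.domRestrict v)) :
    ∃ V : UnitaryOp n, ∀ i ∈ s, ∀ a, (V : Matrix (BitString n) (BitString n) ℂ) a i = v i a := by
  obtain ⟨b, hb⟩ := hv.exists_orthonormalBasis_extension_of_card_eq (by simp)
  refine ⟨⟨(EuclideanSpace.basisFun (BitString n) ℂ).toBasis.toMatrix b,
    OrthonormalBasis.toMatrix_orthonormalBasis_mem_unitary _ _⟩, fun i hi a => ?_⟩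
  simp [Module.Basis.toMatrix_apply, hb i hi]

/-- `V |x⟩⟨x| V†` is the rank-one operator of the column of `V` at `x`. -/
theorem conj_basisProj {κ : Type} [Fintype κ] [DecidableEq κ] (V : Matrix κ κ ℂ) (x : κ) :
    V * basisProj x * Vᴴ = Matrix.vecMulVec (fun a => V a x) (star fun a => V a x) := by
  ext a b
  simp [basisProj, Matrix.mul_apply, Matrix.single_apply, Matrix.vecMulVec_apply, ite_and]

/-! ### Twirls of basis states -/

section Mixture

variable {n q : ℕ}

theorem haarTwirl_eq_twirl (x : Fin q → BitString n) :
    haarTwirl n q x = twirl (powRep n q) (basisProj x) := by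
  rw [twirl_apply, haarTwirl]
  congr 1
  ext1 U
  rw [coe_powRep]
  simp only [tensorPow, tensor_conjTranspose]

theorem orthonormal_single_comp {n : ℕ} {s : Set (BitString n)} {f : BitString n → BitString n}
    (hf : Set.InjOn f s) :
    Orthonormal ℂ (s.domRestrict fun a => EuclideanSpace.single (f a) (1 : ℂ)) :=
  (EuclideanSpace.orthonormal_single (𝕜 := ℂ) (ι := BitString n)).comp (s.domRestrict f)
    (Set.injOn_iff_injective.mp hf)

/-- Unitaries act transitively on tuples of distinct basis vectors, so all such tuples have the
same twirl. -/
theorem twirl_basisProj_eq {x z : Fin q → BitString n} (hx : Function.Injective x)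
    (hz : Function.Injective z) :
    twirl (powRep n q) (basisProj z) = twirl (powRep n q) (basisProj x) := by
  let f : BitString n → BitString n := Function.extend x z id
  have hf : ∀ i, f (x i) = z i := fun i => hx.extend_apply z id i
  have hinj : Set.InjOn f (Set.range x) := by
    rintro _ ⟨i, rfl⟩ _ ⟨j, rfl⟩ h
    rw [hf, hf] at h
    rw [hz h]
  obtain ⟨V, hV⟩ := exists_unitary_of_orthonormal (orthonormal_single_comp hinj)
  rw [← twirl_conj _ V (basisProj x), ← tensor_basisProj x, tensorRep_conj, ← tensor_basisProj z]
  congr 2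
  ext i a b
  have hcol : ∀ a, (V : Matrix (BitString n) (BitString n) ℂ) a (x i) =
      if a = z i then 1 else 0 := fun a => by
    rw [hV _ ⟨i, rfl⟩, hf]
    simp
  change _ = ((V : Matrix (BitString n) (BitString n) ℂ) * basisProj (x i) *
    (V : Matrix (BitString n) (BitString n) ℂ)ᴴ) a b
  rw [conj_basisProj]
  simp only [Matrix.vecMulVec_apply, Pi.star_apply, hcol]
  simp only [basisProj, Matrix.single_apply, eq_comm (a := z i)]
  split_ifs <;> simp_all

theorem card_distinctTuples : (distinctTuples n q).card = (2 ^ n).descFactorial q := by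
  classical
  have h : Fintype.card (Fin q ↪ BitString n) = (2 ^ n).descFactorial q := by
    simp [Fintype.card_embedding_eq]
  rw [← h, distinctTuples, ← Fintype.card_subtype]
  exact Fintype.card_congr (Equiv.subtypeInjectiveEquivEmbedding _ _)

/-- The probability of a collision among `q` uniform strings is at most `q ^ 2 / 2 ^ n`. -/
theorem one_sub_card_distinctTuples_le (hq : q ≤ 2 ^ n) :
    1 - ((distinctTuples n q).card : ℝ) / ((2 : ℝ) ^ n) ^ q ≤ (q : ℝ) ^ 2 / 2 ^ n := by
  have hN : (0 : ℝ) < 2 ^ n := by positivity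
  have h1 : (((2 ^ n + 1 - q) ^ q : ℕ) : ℝ) ≤ ((distinctTuples n q).card : ℝ) := by
    rw [card_distinctTuples]
    exact_mod_cast Nat.pow_sub_le_descFactorial (2 ^ n) q
  have hq' : (q : ℝ) ≤ 2 ^ n := by exact_mod_cast hq
  have hqN : (q : ℝ) / 2 ^ n ≤ 1 := (div_le_one hN).mpr hq'
  have h2 : ((2 : ℝ) ^ n - q) ^ q ≤ (((2 ^ n + 1 - q) ^ q : ℕ) : ℝ) := by
    push_cast [Nat.cast_sub (show q ≤ 2 ^ n + 1 by omega)]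
    exact pow_le_pow_left₀ (by linarith) (by linarith) q
  have h3 := one_add_mul_le_pow (a := -((q : ℝ) / 2 ^ n)) (by linarith) q
  have h4 : (1 + -((q : ℝ) / 2 ^ n)) ^ q = ((2 : ℝ) ^ n - q) ^ q / ((2 : ℝ) ^ n) ^ q := by
    rw [← div_pow]
    congr 1
    field_simp
    ring
  have h5 : ((2 : ℝ) ^ n - q) ^ q / ((2 : ℝ) ^ n) ^ q ≤
      ((distinctTuples n q).card : ℝ) / ((2 : ℝ) ^ n) ^ q :=
    div_le_div_of_nonneg_right (h2.trans h1) (by positivity)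
  have h6 : (q : ℝ) ^ 2 / 2 ^ n = q * ((q : ℝ) / 2 ^ n) := by ring
  linarith

open Classical in
/-- The state `ρ` on the left is the twirl of the collision-free mixture `σ`, and the maximally
mixed state `τ` is its own twirl. Writing `σ - τ = P - Q` gives
`ρ - σ = (twirl P + Q) - (twirl Q + P)`. -/
theorem traceDist_haarTwirl_le (x : Fin q → BitString n) (hx : Function.Injective x) :
    traceDist (haarTwirl n q x) (collisionFreeMixture n q) ≤ 2 * ((q : ℝ) ^ 2 / 2 ^ n) := by
  set S := distinctTuples n q with hS
  have hq : q ≤ 2 ^ n := by simpa using Fintype.card_le_of_injective x hx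
  have hmem : ∀ z, z ∈ S ↔ Function.Injective z := fun z => by simp [hS, distinctTuples]
  have hS0 : 0 < S.card := Finset.card_pos.mpr ⟨x, (hmem x).mpr hx⟩
  have hSC : (S.card : ℂ) ≠ 0 := by exact_mod_cast hS0.ne'
  have hSR : (0 : ℝ) < S.card := by exact_mod_cast hS0
  set T : ℕ := Fintype.card (Fin q → BitString n) with hT
  have hTval : (T : ℝ) = ((2 : ℝ) ^ n) ^ q := by simp [hT]
  have hST : S.card ≤ T := S.card_le_univ
  have hSTR : (S.card : ℝ) ≤ T := by exact_mod_cast hST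
  have hTR : (0 : ℝ) < T := hSR.trans_le hSTR
  set Φ := twirl (powRep n q)
  have hρ : haarTwirl n q x = Φ (collisionFreeMixture n q) := by
    rw [haarTwirl_eq_twirl, collisionFreeMixture, map_smul, map_sum,
      Finset.sum_congr rfl fun z hz => twirl_basisProj_eq hx ((hmem z).mp hz),
      Finset.sum_const, ← Nat.cast_smul_eq_nsmul ℂ, smul_smul, inv_mul_cancel₀ hSC, one_smul]
  set c : ℝ := (S.card : ℝ)⁻¹ - (T : ℝ)⁻¹ with hc
  have hc0 : 0 ≤ c := sub_nonneg.mpr (inv_anti₀ hSR hSTR)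
  set PS : Matrix (Fin q → BitString n) (Fin q → BitString n) ℂ := ∑ z ∈ S, basisProj z
  set PC : Matrix (Fin q → BitString n) (Fin q → BitString n) ℂ := ∑ z ∈ Sᶜ, basisProj z
  have hone : PS + PC = 1 := by
    rw [Finset.sum_add_sum_compl]
    exact Matrix.sum_single_one
  have hPS : PS.PosSemidef := Matrix.posSemidef_sum _ fun z _ => posSemidef_basisProj z
  have hPC : PC.PosSemidef := Matrix.posSemidef_sum _ fun z _ => posSemidef_basisProj z
  have htS : PS.trace = S.card := by simp [PS, Matrix.trace_sum, trace_basisProj]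
  have htC : PC.trace = (T - S.card : ℂ) := by
    simp only [PC, Matrix.trace_sum, trace_basisProj, Finset.sum_const, Finset.card_compl, ← hT]
    rw [nsmul_one, Nat.cast_sub hST]
  have hΦone : Φ 1 = 1 := twirl_eq_self _ fun V => by
    rw [Matrix.mul_one, ← Matrix.star_eq_conjTranspose]
    exact Matrix.mem_unitaryGroup_iff.mp (powRep n q V).2
  set P := (c : ℂ) • PS
  set Q := ((T : ℝ)⁻¹ : ℂ) • PC
  have hP : P.PosSemidef := hPS.smul (by exact_mod_cast hc0)
  have hQ : Q.PosSemidef := hPC.smul (by exact_mod_cast (inv_pos.mpr hTR).le)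
  have hσ : collisionFreeMixture n q = P - Q + ((T : ℝ)⁻¹ : ℂ) • 1 := by
    rw [← hone, collisionFreeMixture]
    simp only [P, Q, hc]
    push_cast
    module
  have hdiff : haarTwirl n q x - collisionFreeMixture n q = (Φ P + Q) - (Φ Q + P) := by
    rw [hρ, hσ, map_add, map_sub, map_smul Φ _ (1 : Matrix _ _ ℂ), hΦone]
    abel
  have htP : P.trace.re = 1 - (S.card : ℝ) / T := by
    simp only [P, Matrix.trace_smul, htS, smul_eq_mul, hc]
    rw [← Complex.ofReal_natCast S.card, ← Complex.ofReal_mul, Complex.ofReal_re]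
    field_simp
  have htQ : Q.trace.re = 1 - (S.card : ℝ) / T := by
    simp only [Q, Matrix.trace_smul, htC, smul_eq_mul]
    rw [← Complex.ofReal_natCast S.card, ← Complex.ofReal_natCast T, ← Complex.ofReal_sub,
      ← Complex.ofReal_inv, ← Complex.ofReal_mul, Complex.ofReal_re]
    field_simp
  have h := traceNorm_sub_le ((posSemidef_twirl (powRep n q) hP).add hQ)
    ((posSemidef_twirl (powRep n q) hQ).add hP)
  rw [← hdiff, Matrix.trace_add, Matrix.trace_add, trace_twirl, trace_twirl, Complex.add_re,
    Complex.add_re, htP, htQ, hTval] at h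
  have h' := one_sub_card_distinctTuples_le hq
  rw [traceDist]
  linarith

end Mixture

/-! ### Tensor powers of a Haar state -/

section HaarPow

variable {n t : ℕ}

/-- The state `E_U (U |0^n⟩⟨0^n| U†)^{⊗ t}`: `t` copies of one Haar state. -/
noncomputable def haarPow (n t : ℕ) :
    Matrix (Fin t → BitString n) (Fin t → BitString n) ℂ :=
  twirl (powRep n t) (tensorPow t (basisProj fun _ => false))

theorem posSemidef_tensorPow_basisProj (x : BitString n) :
    (tensorPow t (basisProj x)).PosSemidef := posSemidef_tensor fun _ => posSemidef_basisProj x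

theorem trace_tensorPow_basisProj (x : BitString n) : (tensorPow t (basisProj x)).trace = 1 := by
  rw [tensorPow, trace_tensor]
  simp [trace_basisProj]

theorem posSemidef_haarPow : (haarPow n t).PosSemidef :=
  posSemidef_twirl _ (posSemidef_tensorPow_basisProj _)

theorem trace_haarPow : (haarPow n t).trace = 1 := by
  rw [haarPow, trace_twirl, trace_tensorPow_basisProj]

/-- The vector `U |0^n⟩` with its coordinates in `W` set to zero. -/
def maskedColumn (W : Finset (BitString n)) (U : UnitaryOp n) (a : BitString n) : ℂ :=
  if a ∈ W then 0 else (U : Matrix (BitString n) (BitString n) ℂ) a fun _ => false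

/-- The projection onto the span of the basis states of `t` registers none of which is in `W`. -/
noncomputable def avoidProj (t : ℕ) (W : Finset (BitString n)) :
    Matrix (Fin t → BitString n) (Fin t → BitString n) ℂ :=
  tensorPow t (Matrix.diagonal fun a => if a ∈ W then 0 else 1)

theorem tensorPow_diagonal (d : BitString n → ℂ) :
    tensorPow t (Matrix.diagonal d) = Matrix.diagonal fun a => ∏ i, d (a i) := by
  ext a b
  rw [tensorPow, tensor_apply]
  simp only [Matrix.diagonal_apply, funext_iff]
  rw [Finset.prod_ite_zero]
  simp

theorem avoidProj_conjTranspose (W : Finset (BitString n)) :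
    (avoidProj t W)ᴴ = avoidProj t W := by
  rw [avoidProj, tensorPow_diagonal, Matrix.diagonal_conjTranspose]
  congr 1
  ext a
  simp [apply_ite]

theorem avoidProj_mul_self (W : Finset (BitString n)) :
    avoidProj t W * avoidProj t W = avoidProj t W := by
  rw [avoidProj, tensorPow, ← tensor_mul]
  simp [← ite_or]

theorem continuous_tensorPow_vecMulVec {v : UnitaryOp n → BitString n → ℂ} (hv : Continuous v) :
    Continuous fun U => tensorPow t (Matrix.vecMulVec (v U) (star (v U))) :=
  continuous_tensor fun _ => hv.matrix_vecMulVec hv.star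

theorem continuous_unitary_apply (a b : BitString n) :
    Continuous fun U : UnitaryOp n => (U : Matrix (BitString n) (BitString n) ℂ) a b :=
  continuous_subtype_val.matrix_elem a b

theorem continuous_maskedColumn (W : Finset (BitString n)) : Continuous (maskedColumn W) := by
  refine continuous_pi fun a => ?_
  unfold maskedColumn
  split_ifs
  · exact continuous_const
  · exact continuous_unitary_apply _ _

/-- Compressing `haarPow` projects each Haar vector onto the coordinates outside `W`, without
normalizing the result. -/
theorem avoidProj_mul_haarPow_mul_avoidProj (W : Finset (BitString n)) :
    avoidProj t W * haarPow n t * avoidProj t W = haarExpect n fun U =>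
      tensorPow t (Matrix.vecMulVec (maskedColumn W U) (star (maskedColumn W U))) := by
  rw [haarPow, twirl_apply, mul_haarExpect_mul _ _ (continuous_conj_rep _ _)]
  congr 1
  ext1 U
  rw [powRep_conj, conj_basisProj, avoidProj, tensorPow, tensorPow, ← tensor_mul, ← tensor_mul]
  refine congrArg tensor (funext fun _ => ?_)
  ext a b
  simp only [Matrix.diagonal_mul, Matrix.mul_diagonal, Matrix.vecMulVec_apply, Pi.star_apply,
    maskedColumn]
  split_ifs <;> simp

/-- The unitary multiplying the basis vectors in `W` by a phase `z`. -/
def phaseUnitary (W : Finset (BitString n)) (z : ℂ) (hz : z * star z = 1) : UnitaryOp n :=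
  ⟨Matrix.diagonal fun a => if a ∈ W then z else 1, by
    rw [Matrix.mem_unitaryGroup_iff, Matrix.star_eq_conjTranspose, Matrix.diagonal_conjTranspose,
      Matrix.diagonal_mul_diagonal, ← Matrix.diagonal_one]
    congr 1
    ext a
    rw [Pi.star_apply]
    split_ifs
    · exact hz
    · simp⟩

/-- Invariance of `haarPow` under phases on `W` kills the matrix entries between basis states with
different numbers of registers in `W`. -/
theorem haarPow_apply_eq_zero (W : Finset (BitString n)) (a b : Fin t → BitString n)
    (h : (Finset.univ.filter fun i => a i ∈ W).card ≠ (Finset.univ.filter fun i => b i ∈ W).card) :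
    haarPow n t a b = 0 := by
  set k := (Finset.univ.filter fun i => a i ∈ W).card
  set l := (Finset.univ.filter fun i => b i ∈ W).card
  have hkl : ((k : ℝ) - l) ≠ 0 := sub_ne_zero.mpr (by exact_mod_cast h)
  -- This angle makes the total phase `z ^ k * conj z ^ l` of the entry equal to `-1`.
  set θ : ℝ := Real.pi / (k - l) with hθ
  set z : ℂ := Complex.exp (θ * Complex.I) with hz
  have hstar : star z = Complex.exp (-(θ * Complex.I)) := by
    rw [← starRingEnd_apply, hz, ← Complex.exp_conj]
    simp
  have hzz : z * star z = 1 := by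
    rw [hstar, hz, ← Complex.exp_add]
    simp
  have hinv := congrFun (congrFun (conj_twirl (powRep n t) (phaseUnitary W z hzz)
    (tensorPow t (basisProj fun _ => false))) a) b
  have hdiag : (powRep n t (phaseUnitary W z hzz) :
      Matrix (Fin t → BitString n) (Fin t → BitString n) ℂ) =
      Matrix.diagonal fun a => ∏ i, if a i ∈ W then z else 1 :=
    tensorPow_diagonal _
  rw [hdiag, Matrix.diagonal_conjTranspose, Matrix.mul_diagonal, Matrix.diagonal_mul] at hinv
  change _ * haarPow n t a b * _ = haarPow n t a b at hinv
  have hprod : ∀ c : Fin t → BitString n, (∏ i, if c i ∈ W then z else 1) =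
      z ^ (Finset.univ.filter fun i => c i ∈ W).card := fun c => by
    simp [Finset.prod_ite]
  rw [Pi.star_apply, hprod, hprod, star_pow, hstar, hz, ← Complex.exp_nat_mul,
    ← Complex.exp_nat_mul, mul_right_comm, ← Complex.exp_add] at hinv
  have harg : (k : ℂ) * (θ * Complex.I) + l * (-(θ * Complex.I)) = Real.pi * Complex.I := by
    have h1 : ((k : ℝ) - l) * θ = Real.pi := by
      rw [hθ]
      field_simp
    rw [← h1]
    push_cast
    ring
  rw [harg, Complex.exp_pi_mul_I] at hinv
  linear_combination (-1 / 2 : ℂ) * hinv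

theorem avoidProj_mul_haarPow (W : Finset (BitString n)) :
    avoidProj t W * haarPow n t = haarPow n t * avoidProj t W := by
  ext a b
  rw [avoidProj, tensorPow_diagonal, Matrix.diagonal_mul, Matrix.mul_diagonal]
  by_cases h : (Finset.univ.filter fun i => a i ∈ W).card =
      (Finset.univ.filter fun i => b i ∈ W).card
  · rw [Finset.prod_ite, Finset.prod_ite, Finset.prod_const, Finset.prod_const, h]
    simp [mul_comm]
  · simp [haarPow_apply_eq_zero W a b h]

theorem haarPow_eq_add (W : Finset (BitString n)) :
    haarPow n t = avoidProj t W * haarPow n t * avoidProj t W +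
      (1 - avoidProj t W) * haarPow n t * (1 - avoidProj t W)ᴴ := by
  rw [Matrix.conjTranspose_sub, Matrix.conjTranspose_one, avoidProj_conjTranspose]
  have h : avoidProj t W * haarPow n t * avoidProj t W = haarPow n t * avoidProj t W := by
    rw [avoidProj_mul_haarPow, Matrix.mul_assoc, avoidProj_mul_self]
  rw [h, Matrix.sub_mul 1, Matrix.one_mul, avoidProj_mul_haarPow, Matrix.mul_sub, Matrix.mul_one,
    Matrix.sub_mul, Matrix.mul_assoc, avoidProj_mul_self]
  abel

/-- The average of `‖P U |0^n⟩‖ ^ (2 t)`, where `P` sets the coordinates in `W` to zero. -/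
noncomputable def avoidWeight (t : ℕ) (W : Finset (BitString n)) : ℝ :=
  ∫ U, (∑ a, ‖maskedColumn W U a‖ ^ 2) ^ t ∂haarUnitary n

theorem sum_norm_sq_column (U : UnitaryOp n) (e : BitString n) :
    ∑ a, ‖(U : Matrix (BitString n) (BitString n) ℂ) a e‖ ^ 2 = 1 := by
  have h := congrFun (congrFun (Matrix.UnitaryGroup.star_mul_self U) e) e
  rw [Matrix.mul_apply, Matrix.one_apply_eq] at h
  have h2 := congrArg Complex.re h
  rw [Complex.re_sum, Complex.one_re] at h2
  rw [← h2]
  refine Finset.sum_congr rfl fun a _ => ?_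
  rw [Matrix.star_apply, ← starRingEnd_apply, mul_comm, Complex.mul_conj, Complex.ofReal_re,
    Complex.normSq_eq_norm_sq]

theorem integrable_norm_sq_apply (a e : BitString n) :
    Integrable (fun U : UnitaryOp n => ‖(U : Matrix (BitString n) (BitString n) ℂ) a e‖ ^ 2)
      (haarUnitary n) :=
  integrable_haarUnitary ((continuous_unitary_apply a e).norm.pow 2)

theorem integral_norm_sq_apply (a e : BitString n) :
    ∫ U : UnitaryOp n, ‖(U : Matrix (BitString n) (BitString n) ℂ) a e‖ ^ 2 ∂haarUnitary n =
      1 / 2 ^ n := by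
  have hsymm : ∀ b, ∫ U : UnitaryOp n, ‖(U : Matrix (BitString n) (BitString n) ℂ) b e‖ ^ 2
      ∂haarUnitary n = ∫ U : UnitaryOp n,
        ‖(U : Matrix (BitString n) (BitString n) ℂ) a e‖ ^ 2 ∂haarUnitary n := by
    intro b
    have hv : Orthonormal ℂ (({b} : Set (BitString n)).domRestrict
        fun _ => EuclideanSpace.single a (1 : ℂ)) := by
      refine ⟨fun _ => by simp, fun i j hij => absurd (Subsingleton.elim i j) hij⟩
    obtain ⟨V, hV⟩ := exists_unitary_of_orthonormal hv
    rw [← integral_mul_left_eq_self _ (star V)]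
    refine integral_congr_ae (Filter.Eventually.of_forall fun U => ?_)
    have hentry : ((star V * U : UnitaryOp n) : Matrix (BitString n) (BitString n) ℂ) b e =
        (U : Matrix (BitString n) (BitString n) ℂ) a e := by
      simp [Matrix.mul_apply, Matrix.star_apply, hV b rfl]
    simp only [hentry]
  have hsum : ∑ b, ∫ U : UnitaryOp n, ‖(U : Matrix (BitString n) (BitString n) ℂ) b e‖ ^ 2
      ∂haarUnitary n = 1 := by
    rw [← integral_finsetSum _ fun b _ => integrable_norm_sq_apply b e]
    simp [sum_norm_sq_column]
  rw [Finset.sum_congr rfl fun b _ => hsymm b, Finset.sum_const, nsmul_eq_mul] at hsum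
  have hcard : ((Finset.univ : Finset (BitString n)).card : ℝ) = 2 ^ n := by simp
  rw [hcard] at hsum
  rw [eq_div_iff (by positivity), mul_comm]
  exact hsum

theorem sum_norm_sq_maskedColumn (W : Finset (BitString n)) (U : UnitaryOp n) :
    ∑ a, ‖maskedColumn W U a‖ ^ 2 =
      1 - ∑ a ∈ W, ‖(U : Matrix (BitString n) (BitString n) ℂ) a fun _ => false‖ ^ 2 := by
  rw [← sum_norm_sq_column U fun _ => false, ← Finset.sum_add_sum_compl W fun a =>
    ‖(U : Matrix (BitString n) (BitString n) ℂ) a fun _ => false‖ ^ 2, add_sub_cancel_left,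
    ← Finset.sum_add_sum_compl W, Finset.sum_eq_zero, zero_add]
  · refine Finset.sum_congr rfl fun a ha => ?_
    rw [maskedColumn, if_neg (Finset.mem_compl.mp ha)]
  · intro a ha
    simp [maskedColumn, ha]

/-- By Bernoulli's inequality, since `U |0^n⟩` has weight `|W| / 2 ^ n` on `W` on average. -/
theorem le_avoidWeight (t : ℕ) (W : Finset (BitString n)) :
    1 - (t : ℝ) * (W.card / 2 ^ n) ≤ avoidWeight t W := by
  have hint : Integrable (fun U : UnitaryOp n => (t : ℝ) *
      ∑ a ∈ W, ‖(U : Matrix (BitString n) (BitString n) ℂ) a fun _ => false‖ ^ 2)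
      (haarUnitary n) :=
    (integrable_finsetSum _ fun a _ => integrable_norm_sq_apply a _).const_mul _
  have hlin : ∫ U : UnitaryOp n, (1 - (t : ℝ) *
      ∑ a ∈ W, ‖(U : Matrix (BitString n) (BitString n) ℂ) a fun _ => false‖ ^ 2)
      ∂haarUnitary n = 1 - (t : ℝ) * (W.card / 2 ^ n) := by
    rw [integral_sub (integrable_const _) hint, integral_const_mul,
      integral_finsetSum _ fun a _ => integrable_norm_sq_apply a _]
    simp [integral_norm_sq_apply, div_eq_mul_inv]
  rw [← hlin, avoidWeight]
  refine integral_mono ((integrable_const _).sub hint) (integrable_haarUnitary ?_) fun U => ?_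
  · exact (continuous_finsetSum _ fun a _ =>
      ((continuous_apply a).comp (continuous_maskedColumn W)).norm.pow 2).pow t
  · have hw : ∑ a ∈ W, ‖(U : Matrix (BitString n) (BitString n) ℂ) a fun _ => false‖ ^ 2 ≤ 1 := by
      rw [← sum_norm_sq_column U fun _ => false]
      exact Finset.sum_le_univ_sum_of_nonneg fun _ => by positivity
    have h := one_add_mul_le_pow (a := -∑ a ∈ W,
      ‖(U : Matrix (BitString n) (BitString n) ℂ) a fun _ => false‖ ^ 2) (by linarith) t
    simp only [sum_norm_sq_maskedColumn]
    rw [← sub_eq_add_neg] at h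
    linarith

end HaarPow

/-! ### Replacing independent Haar states one at a time -/

section Hybrid

variable {n s t : ℕ}

/-- A vector orthogonal to the basis vectors in `W` is, up to its norm, the image of `|e⟩` under a
unitary fixing those basis vectors. -/
theorem exists_unitary_fixing (W : Finset (BitString n)) {e : BitString n} (he : e ∉ W)
    {v : BitString n → ℂ} (hv : ∀ a ∈ W, v a = 0) :
    ∃ V : UnitaryOp n,
      (∀ b ∈ W, ∀ a, (V : Matrix (BitString n) (BitString n) ℂ) a b = if a = b then 1 else 0) ∧
      ∀ a, v a = (√(∑ a, ‖v a‖ ^ 2) : ℝ) * (V : Matrix (BitString n) (BitString n) ℂ) a e := by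
  by_cases hv0 : v = 0
  · exact ⟨1, fun b _ a => by simp [Matrix.one_apply], fun a => by simp [hv0]⟩
  set v' : EuclideanSpace ℂ (BitString n) := WithLp.toLp 2 v
  have hv'0 : v' ≠ 0 := fun h => hv0 (by simpa [v'] using h)
  have hnorm : √(∑ a, ‖v a‖ ^ 2) = ‖v'‖ := (EuclideanSpace.norm_eq v').symm
  have hr : (‖v'‖ : ℂ) ≠ 0 := by exact_mod_cast norm_ne_zero_iff.mpr hv'0
  let f : BitString n → EuclideanSpace ℂ (BitString n) := fun i =>
    if i = e then ((‖v'‖ : ℂ)⁻¹) • v' else EuclideanSpace.single i 1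
  have hfe : f e = ((‖v'‖ : ℂ)⁻¹) • v' := if_pos rfl
  have hfW : ∀ i ∈ W, f i = EuclideanSpace.single i 1 := fun i hi =>
    if_neg (ne_of_mem_of_not_mem hi he)
  have hWe : ∀ i ∈ W, inner ℂ (f i) (f e) = 0 := fun i hi => by
    rw [hfW i hi, hfe, inner_smul_right, EuclideanSpace.inner_single_left]
    simp [v', hv i hi]
  have horth : Orthonormal ℂ ((insert e (W : Set (BitString n))).domRestrict f) := by
    refine ⟨?_, ?_⟩
    · rintro ⟨i, rfl | hi⟩
      · change ‖f i‖ = 1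
        rw [hfe, norm_smul, norm_inv, Complex.norm_real, norm_norm]
        exact inv_mul_cancel₀ (norm_ne_zero_iff.mpr hv'0)
      · change ‖f i‖ = 1
        rw [hfW i hi]
        simp
    · rintro ⟨i, rfl | hi⟩ ⟨j, rfl | hj⟩ hij
      · exact absurd rfl hij
      · exact inner_eq_zero_symm.mp (hWe j hj)
      · exact hWe i hi
      · change inner ℂ (f i) (f j) = 0
        have hne : i ≠ j := fun h => hij (Subtype.ext h)
        rw [hfW i hi, hfW j hj, EuclideanSpace.inner_single_left]
        simp [hne]
  obtain ⟨V, hV⟩ := exists_unitary_of_orthonormal horth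
  refine ⟨V, fun b hb a => ?_, fun a => ?_⟩
  · rw [hV b (Or.inr hb), hfW b hb]
    simp
  · rw [hV e (Or.inl rfl), hfe, hnorm]
    simp [v', hr]

theorem commonHaarState_eq_twirl (x : Fin s → BitString n) :
    commonHaarState n s t x =
      twirl (tensorRep (Fin s) (powRep n t)) (tensor fun j => tensorPow t (basisProj (x j))) := by
  rw [twirl_apply, commonHaarState]
  congr 1
  ext1 U
  rw [tensorRep_conj]
  simp only [powRep_conj]

theorem iidHaarState_eq : iidHaarState n s t = tensor fun _ => haarPow n t := by
  rw [iidHaarState]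
  refine congrArg tensor (funext fun _ => ?_)
  rw [haarPow, twirl_apply]
  simp only [powRep_conj]

/-- The factors of the `k`-th hybrid: `t` copies of the basis state `|x_j⟩` for `j < k`, and an
independent Haar state for `j ≥ k`. -/
noncomputable def hybridFactor (t : ℕ) (x : Fin s → BitString n) (k : ℕ) (j : Fin s) :
    Matrix (Fin t → BitString n) (Fin t → BitString n) ℂ :=
  if (j : ℕ) < k then tensorPow t (basisProj (x j)) else haarPow n t

/-- The `k`-th hybrid: the first `k` registers hold columns of one Haar unitary, the others hold
independent Haar states. The twirl does not affect the latter. -/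
noncomputable def hybrid (t : ℕ) (x : Fin s → BitString n) (k : ℕ) :
    Matrix (Fin s → Fin t → BitString n) (Fin s → Fin t → BitString n) ℂ :=
  twirl (tensorRep (Fin s) (powRep n t)) (tensor (hybridFactor t x k))

theorem posSemidef_hybridFactor (x : Fin s → BitString n) (k : ℕ) (j : Fin s) :
    (hybridFactor t x k j).PosSemidef := by
  unfold hybridFactor
  split_ifs
  · exact posSemidef_tensorPow_basisProj _
  · exact posSemidef_haarPow

theorem posSemidef_hybrid (x : Fin s → BitString n) (k : ℕ) : (hybrid t x k).PosSemidef :=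
  posSemidef_twirl _ (posSemidef_tensor fun j => posSemidef_hybridFactor x k j)

theorem trace_hybrid (x : Fin s → BitString n) (k : ℕ) : (hybrid t x k).trace = 1 := by
  rw [hybrid, trace_twirl, trace_tensor]
  refine Finset.prod_eq_one fun j _ => ?_
  unfold hybridFactor
  split_ifs
  · exact trace_tensorPow_basisProj _
  · exact trace_haarPow

theorem hybrid_zero (x : Fin s → BitString n) : hybrid t x 0 = iidHaarState n s t := by
  rw [hybrid, iidHaarState_eq]
  refine (twirl_eq_self _ fun V => ?_).trans ?_
  · rw [tensorRep_conj]
    refine congrArg tensor (funext fun j => ?_)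
    rw [hybridFactor, if_neg (Nat.not_lt_zero _)]
    exact conj_twirl _ _ _
  · exact congrArg tensor (funext fun j => if_neg (Nat.not_lt_zero _))

theorem hybrid_last (x : Fin s → BitString n) : hybrid t x s = commonHaarState n s t x := by
  rw [hybrid, commonHaarState_eq_twirl]
  exact congrArg _ (congrArg tensor (funext fun j => if_pos j.is_lt))

theorem tensorSlot_hybridFactor_haarPow (x : Fin s → BitString n) (k : Fin s) :
    tensorSlot (hybridFactor t x k) k (haarPow n t) = tensor (hybridFactor t x k) := by
  rw [tensorSlot_apply]
  refine congrArg tensor (Function.update_eq_self_iff.mpr ?_)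
  simp [hybridFactor]

theorem tensorPow_smul (c : ℂ) (M : Matrix (BitString n) (BitString n) ℂ) :
    tensorPow t (c • M) = c ^ t • tensorPow t M := by
  rw [tensorPow, tensor_smul]
  simp [tensorPow]

/-- Placing `t` copies of a fixed vector `v` orthogonal to `|x_j⟩`, `j < k`, in position `k` of the
`k`-th hybrid gives a multiple of the next hybrid: a unitary fixing those `|x_j⟩` moves `|x_k⟩` to
`v / ‖v‖`, and the twirl absorbs it. -/
theorem twirl_tensorSlot_vecMulVec {x : Fin s → BitString n} (hx : Function.Injective x)
    (k : Fin s) {v : BitString n → ℂ} (hv : ∀ j < k, v (x j) = 0) :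
    twirl (tensorRep (Fin s) (powRep n t)) (tensorSlot (hybridFactor t x k) k
      (tensorPow t (Matrix.vecMulVec v (star v)))) =
      ((∑ a, ‖v a‖ ^ 2 : ℝ) : ℂ) ^ t • hybrid t x (k + 1) := by
  have hk : x k ∉ (Finset.univ.filter (· < k)).image x := by
    simp [hx.eq_iff]
  obtain ⟨V, hfix, hcol⟩ := exists_unitary_fixing _ hk (v := v) (by simpa using hv)
  set r : ℝ := √(∑ a, ‖v a‖ ^ 2)
  have hr : ((∑ a, ‖v a‖ ^ 2 : ℝ) : ℂ) = (r : ℂ) ^ 2 := by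
    rw [← Complex.ofReal_pow, Real.sq_sqrt (Finset.sum_nonneg fun _ _ => by positivity)]
  have hvv : Matrix.vecMulVec v (star v) = ((r : ℂ) ^ 2) •
      ((V : Matrix (BitString n) (BitString n) ℂ) * basisProj (x k) *
        (V : Matrix (BitString n) (BitString n) ℂ)ᴴ) := by
    rw [conj_basisProj]
    ext a b
    simp only [Matrix.vecMulVec_apply, Matrix.smul_apply, Pi.star_apply, smul_eq_mul]
    rw [hcol a, hcol b, star_mul', ← starRingEnd_apply, ← starRingEnd_apply, Complex.conj_ofReal]
    ring
  rw [hvv, tensorPow_smul, map_smul, map_smul, hr]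
  congr 1
  rw [hybrid, ← twirl_conj _ V (tensor (hybridFactor t x (k + 1))), tensorRep_conj,
    tensorSlot_apply]
  congr 2
  ext1 j
  rcases lt_trichotomy j k with hj | rfl | hj
  · have hVj : (V : Matrix (BitString n) (BitString n) ℂ) * basisProj (x j) *
        (V : Matrix (BitString n) (BitString n) ℂ)ᴴ = basisProj (x j) := by
      rw [conj_basisProj]
      ext a b
      have h := hfix (x j) (by simp [hx.eq_iff, hj])
      simp only [Matrix.vecMulVec_apply, Pi.star_apply, h]
      simp only [basisProj, Matrix.single_apply, eq_comm (a := x j)]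
      split_ifs <;> simp_all
    have h1 : (j : ℕ) < k := hj
    rw [Function.update_of_ne hj.ne, hybridFactor, hybridFactor, if_pos h1,
      if_pos (Nat.lt_succ_of_lt h1), powRep_conj, hVj]
  · rw [Function.update_self, hybridFactor, if_pos (Nat.lt_succ_self _), powRep_conj]
  · have h1 : ¬ (j : ℕ) < k := not_lt.mpr (le_of_lt hj)
    have h2 : ¬ (j : ℕ) < k + 1 := not_lt.mpr hj
    rw [Function.update_of_ne hj.ne', hybridFactor, hybridFactor, if_neg h1, if_neg h2]
    exact (conj_twirl _ _ _).symm

/-- Consecutive hybrids: splitting the `k`-th Haar state into its part orthogonal to the `|x_j⟩`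
with `j < k` and the rest, the first part yields the next hybrid with weight `c`. -/
theorem exists_hybrid_eq {x : Fin s → BitString n} (hx : Function.Injective x) (k : Fin s) :
    ∃ c : ℝ, 1 - (t : ℝ) * (s / 2 ^ n) ≤ c ∧
      ∃ Q : Matrix (Fin s → Fin t → BitString n) (Fin s → Fin t → BitString n) ℂ,
        Q.PosSemidef ∧ hybrid t x k = (c : ℂ) • hybrid t x (k + 1) + Q := by
  set W := (Finset.univ.filter (· < k)).image x with hW
  set Φ := (twirl (tensorRep (Fin s) (powRep n t))).comp (tensorSlot (hybridFactor t x k) k)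
    with hΦ
  refine ⟨avoidWeight t W, ?_, Φ ((1 - avoidProj t W) * haarPow n t * (1 - avoidProj t W)ᴴ),
    ?_, ?_⟩
  · refine le_trans ?_ (le_avoidWeight t W)
    have hcard : (W.card : ℝ) ≤ s := by
      have h : W.card ≤ Fintype.card (Fin s) := Finset.card_image_le.trans (Finset.card_le_univ _)
      rw [Fintype.card_fin] at h
      exact_mod_cast h
    gcongr
  · refine posSemidef_twirl _ (posSemidef_tensor fun j => ?_)
    rcases eq_or_ne j k with rfl | hj
    · rw [Function.update_self]
      exact posSemidef_haarPow.mul_mul_conjTranspose_same _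
    · rw [Function.update_of_ne hj]
      exact posSemidef_hybridFactor x k j
  · have hmain : Φ (avoidProj t W * haarPow n t * avoidProj t W) =
        (avoidWeight t W : ℂ) • hybrid t x (k + 1) := by
      rw [avoidProj_mul_haarPow_mul_avoidProj, map_haarExpect_matrix Φ
        (continuous_tensorPow_vecMulVec (continuous_maskedColumn W))]
      have hU : ∀ U, Φ (tensorPow t (Matrix.vecMulVec (maskedColumn W U)
          (star (maskedColumn W U)))) =
          (((∑ a, ‖maskedColumn W U a‖ ^ 2) ^ t : ℝ) : ℂ) • hybrid t x (k + 1) := fun U => by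
        rw [Complex.ofReal_pow]
        refine twirl_tensorSlot_vecMulVec hx k fun j hj => ?_
        exact if_pos (Finset.mem_image_of_mem x (by simpa using hj))
      simp only [hU]
      rw [haarExpect_integral_smul, integral_complex_ofReal, avoidWeight]
    rw [← hmain, ← map_add, ← haarPow_eq_add, hΦ, LinearMap.comp_apply,
      tensorSlot_hybridFactor_haarPow, hybrid]

theorem traceDist_commonHaarState_le {x : Fin s → BitString n} (hx : Function.Injective x) :
    traceDist (commonHaarState n s t x) (iidHaarState n s t) ≤ (s : ℝ) ^ 2 * t / 2 ^ n := by
  choose c hc Q hQ hstep using exists_hybrid_eq (t := t) hx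
  have htQ : ∀ k, (Q k).trace = ((1 - c k : ℝ) : ℂ) := fun k => by
    have h := congrArg Matrix.trace (hstep k)
    rw [Matrix.trace_add, Matrix.trace_smul, trace_hybrid, trace_hybrid, smul_eq_mul,
      mul_one] at h
    push_cast
    linear_combination -h
  have hc1 : ∀ k, 0 ≤ 1 - c k := fun k => by
    have h := (hQ k).trace_nonneg
    rw [htQ] at h
    exact_mod_cast h
  have hdiff : commonHaarState n s t x - iidHaarState n s t =
      ∑ k : Fin s, ((1 - c k : ℝ) : ℂ) • hybrid t x (k + 1) - ∑ k, Q k := by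
    rw [← hybrid_last, ← hybrid_zero x, ← Finset.sum_range_sub, ← Fin.sum_univ_eq_sum_range
      (fun k => hybrid t x (k + 1) - hybrid t x k), ← Finset.sum_sub_distrib]
    refine Finset.sum_congr rfl fun k _ => ?_
    rw [hstep k]
    push_cast
    module
  have h := traceNorm_sub_le
    (Matrix.posSemidef_sum Finset.univ fun k _ =>
      (posSemidef_hybrid (t := t) x ((k : Fin s) + 1)).smul
        (show (0 : ℂ) ≤ ((1 - c k : ℝ) : ℂ) by exact_mod_cast hc1 k))
    (Matrix.posSemidef_sum Finset.univ fun k _ => hQ k)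
  have hsum : ∑ k, (1 - c k) ≤ (s : ℝ) ^ 2 * t / 2 ^ n := by
    calc ∑ k, (1 - c k) ≤ ∑ _k : Fin s, (t : ℝ) * (s / 2 ^ n) :=
          Finset.sum_le_sum fun k _ => by linarith [hc k]
      _ = (s : ℝ) ^ 2 * t / 2 ^ n := by
          rw [Finset.sum_const, Finset.card_univ, Fintype.card_fin, nsmul_eq_mul]
          ring
  rw [← hdiff, Matrix.trace_sum, Matrix.trace_sum] at h
  simp only [Matrix.trace_smul, trace_hybrid, htQ, smul_eq_mul, mul_one, Complex.re_sum,
    Complex.ofReal_re] at h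
  rw [traceDist]
  linarith

end Hybrid

end HaarPerp

theorem mainTheorem3 :
    (∃ C : ℝ, ∀ (n s t : ℕ) (x : Fin s → HaarPerp.BitString n), Function.Injective x →
      HaarPerp.traceDist (HaarPerp.commonHaarState n s t x) (HaarPerp.iidHaarState n s t) ≤
        C * ((s : ℝ) ^ 2 * (t : ℝ) / (2 : ℝ) ^ n)) ∧
    (∃ C : ℝ, ∀ (n q : ℕ) (x : Fin q → HaarPerp.BitString n), Function.Injective x →
      HaarPerp.traceDist (HaarPerp.haarTwirl n q x) (HaarPerp.collisionFreeMixture n q) ≤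
        C * ((q : ℝ) ^ 2 / (2 : ℝ) ^ n)) := by
  refine ⟨⟨1, fun n s t x hx => ?_⟩, ⟨2, fun n q x hx => ?_⟩⟩
  · rw [one_mul]
    exact HaarPerp.traceDist_commonHaarState_le hx
  · exact HaarPerp.traceDist_haarTwirl_le x hx
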